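/- Let $k\ge 2$, let $\mathcal C$ be a set of colours and let $G$ and $H$ be directed graphs (loops allowed) with vertex sets $[n]$ and $[m]$ whose vertices are coloured with elements of $\mathcal C$. \textbf{Weisfeiler--Leman.} The isomorphism type of a $k$-tuple $\bar v$ of vertices consists of the colours of the $v_i$, of the pairs $(i,j)$ with $v_i=v_j$ and of the pairs $(i,j)$ such that $(v_i,v_j)$ is an edge. Let $\chi^{(0)}(\bar v)$ be this isomorphism type and, for $t>0$, $$\chi^{(t)}(\bar v)=\textsc{Hash}\Bigl(\chi^{(t-1)}(\bar v),\bigl(\textsc{Hash}\{\!\!\{\chi^{(t-1)}(\bar v[v_i/x])\mid x \text{ a vertex}\}\!\!\}\bigr)_{i=1}^{k}\Bigr),$$ where $\textsc{Hash}$ is injective (and the same for both graphs) and $\bar v[v_i/x]$ is $\bar v$ with its $i$-th entry replaced by $x$. We say that $k$-WL does not distinguish $G$ and $H$ if for every $t\ge 0$ the multiset of the colours $\chi^{(t)}$ of all $k$-tuples of $G$ equals that of all $k$-tuples of $H$. \textbf{Invariant graph networks.} For $\mathbf A\in\mathbb R^{n^k\times p}$ and $\pi\in S_n$ define $\pi\star\mathbf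 A$ by $(\pi\star\mathbf A)_{\pi(\bar v),\bullet}=\mathbf A_{\bar v,\bullet}$. A $k$-th order equivariant linear layer is an affine map (a linear map plus a bias) $L:\mathbb R^{n^k\times p}\to\mathbb R^{n^k\times q}$ with $L(\pi\star\mathbf A)=\pi\star L(\mathbf A)$ for all $\pi$ and $\mathbf A$; an invariant layer is an affine map $I:\mathbb R^{n^k\times p}\to\mathbb R^{q}$ with $I(\pi\star\mathbf A)=I(\mathbf A)$. A $k$-th order invariant linear graph network ($k$-IGN) is a function of the form $$F=M\circ I\circ\sigma\circ L^{(d)}\circ\cdots\circ\sigma\circ L^{(1)}:\mathbb R^{n^k\times s_0}\to\mathbb R^{s}$$ with equivariant linear layers $L^{(i)}$, an activation function $\sigma:\mathbb R\to\mathbb R$ applied entrywise, an invariant layer $I$ and a multilayer perceptron $M$ (with an arbitrary activation function $\mathbb R\to\mathbb R$). Let $c_1,\dots,c_{s_0}$ be distinct isomorphism types among which are those of all $k$-tuples of $G$ and of $H$, and let $\mathbf A_G\in\mathbb R^{n^k\times s_0}$ be given by $(\mathbf A_G)_{\bar v,a}=1$ if $\bar v$ has isomorphism type $c_a$ in $G$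 and $(\mathbf A_G)_{\bar v,a}=0$ otherwise; similarly $\mathbf A_H$. \textbf{Theorem.} If $k$-WL does not distinguish $G$ and $H$, then $n=m$ and $F(\mathbf A_G)=F(\mathbf A_H)$ for every $s$ and every $k$-IGN $F:\mathbb R^{n^k\times s_0}\to\mathbb R^s$. Conversely, there are an $s$ and a $k$-IGN $F:\mathbb R^{n^k\times s_0}\to\mathbb R^s$, with all activation functions equal to $\mathrm{ReLU}$, such that if $n=m$ and $F(\mathbf A_G)=F(\mathbf A_H)$, then $k$-WL does not distinguish $G$ and $H$. Hence $k$-IGNs and $k$-WL have the same power to distinguish graphs. -/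

import Mathlib

namespace WLIGN

universe u

/-! ### Coloured graphs and the Weisfeiler-Leman test on tuples -/

/-- A directed graph (loops allowed) with vertex set `V` whose vertices carry colours in `C`. -/
structure ColouredDigraph (V : Type) (C : Type u) extends Digraph V where
  /-- the colour of a vertex -/
  colour : V → C

/-- The possible isomorphism types of a `k`-tuple of vertices: the colours of its entries, which
pairs of entries are equal, and which pairs of entries are edges. -/
@[ext]
structure IsoType (k : ℕ) (C : Type u) : Type u where
  /-- colours of the entries -/
  colour : Fin k → C
  /-- pairs of positions with equal entries -/
  same : Fin k → Fin k → Prop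
  /-- pairs of positions whose entries form an edge -/
  edge : Fin k → Fin k → Prop

/-- The isomorphism type of the `k`-tuple `v` in `G`, i.e. its initial colour. -/
def isoType {V : Type} {C : Type u} {k : ℕ} (G : ColouredDigraph V C) (v : Fin k → V) :
    IsoType k C where
  colour i := G.colour (v i)
  same i j := v i = v j
  edge i j := G.Adj (v i) (v j)

/-- The colours available in round `t` of `k`-WL. The injective hash function is taken to be the
identity, so a colour is the hashed data itself; in this way colours of tuples
of different graphs can be compared. -/
def WLColour (k : ℕ) (C : Type u) : ℕ → Type u
  | 0 => IsoType k C
  | t + 1 => WLColour k C t × (Fin k → Multiset (WLColour k C t))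

/-- The colouring of `k`-tuples produced by `k`-WL after `t` rounds. The tuple
`Function.update v i x` is `v` with its `i`-th entry replaced by `x`. -/
def wlColour {n : ℕ} {C : Type u} {k : ℕ} (G : ColouredDigraph (Fin n) C) :
    (t : ℕ) → (Fin k → Fin n) → WLColour k C t
  | 0, v => isoType G v
  | t + 1, v =>
      (wlColour G t v,
        fun i => (Finset.univ : Finset (Fin n)).val.map
          fun x => wlColour G t (Function.update v i x))

/-- `k`-WL does not distinguish `G` and `H` in round `t`: the multisets of colours agree. -/
def WLIndistAt {n m : ℕ} {C : Type u} (k t : ℕ)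
    (G : ColouredDigraph (Fin n) C) (H : ColouredDigraph (Fin m) C) : Prop :=
  (Finset.univ : Finset (Fin k → Fin n)).val.map (wlColour G t) =
    (Finset.univ : Finset (Fin k → Fin m)).val.map (wlColour H t)

/-- `k`-WL does not distinguish `G` and `H` (in any round). -/
def WLIndist {n m : ℕ} {C : Type u} (k : ℕ)
    (G : ColouredDigraph (Fin n) C) (H : ColouredDigraph (Fin m) C) : Prop :=
  ∀ t : ℕ, WLIndistAt k t G H

/-! ### Invariant graph networks -/

/-- `k`-th order tensors with `p` features, the space `ℝ^(n^k × p)`. -/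
abbrev Tensor (n k p : ℕ) : Type := (Fin k → Fin n) → Fin p → ℝ

/-- The action of permutations on tensors, characterised by `(π ⋆ A)_(π v) = A_v`. -/
def permAct {n k p : ℕ} (π : Equiv.Perm (Fin n)) (A : Tensor n k p) : Tensor n k p :=
  fun v => A fun i => π.symm (v i)

theorem permAct_apply {n k p : ℕ} (π : Equiv.Perm (Fin n)) (A : Tensor n k p)
    (v : Fin k → Fin n) : permAct π A (fun i => π (v i)) = A v := by
  simp [permAct]

/-- An equivariant linear layer `ℝ^(n^k × p) → ℝ^(n^k × q)`. As usual for network layers, a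
constant (bias) term is allowed, so the map is affine. -/
structure EquivariantLayer (n k p q : ℕ) where
  /-- the underlying affine map -/
  toMap : Tensor n k p →ᵃ[ℝ] Tensor n k q
  equivariant : ∀ (π : Equiv.Perm (Fin n)) (A : Tensor n k p),
    toMap (permAct π A) = permAct π (toMap A)

/-- An invariant linear layer `ℝ^(n^k × p) → ℝ^q`, again with a bias term. -/
structure InvariantLayer (n k p q : ℕ) where
  /-- the underlying affine map -/
  toMap : Tensor n k p →ᵃ[ℝ] (Fin q → ℝ)
  invariant : ∀ (π : Equiv.Perm (Fin n)) (A : Tensor n k p), toMap (permAct π A) = toMap A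

/-- Finite sequences `L⁽¹⁾, …, L⁽ᵈ⁾` of composable equivariant layers. -/
inductive EquivariantStack (n k : ℕ) : ℕ → ℕ → Type
  | nil (p : ℕ) : EquivariantStack n k p p
  | snoc {p q r : ℕ} (S : EquivariantStack n k p q) (L : EquivariantLayer n k q r) :
      EquivariantStack n k p r

/-- The function `σ ∘ L⁽ᵈ⁾ ∘ ⋯ ∘ σ ∘ L⁽¹⁾`, where `σ` is applied to each entry of a tensor. -/
def EquivariantStack.eval {n k : ℕ} (σ : ℝ → ℝ) :
    {p q : ℕ} → EquivariantStack n k p q → Tensor n k p → Tensor n k q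
  | _, _, .nil _, A => A
  | _, _, .snoc S L, A => fun v a => σ (L.toMap (S.eval σ A) v a)

/-- Multilayer perceptrons from `ℝ^p` to `ℝ^q`: a positive number of affine maps, between
which the activation function is applied. -/
inductive MLP : ℕ → ℕ → Type
  | last {p q : ℕ} (W : (Fin p → ℝ) →ᵃ[ℝ] (Fin q → ℝ)) : MLP p q
  | cons {p q r : ℕ} (W : (Fin p → ℝ) →ᵃ[ℝ] (Fin q → ℝ)) (M : MLP q r) : MLP p r

/-- The function computed by a multilayer perceptron with activation function `ρ`. -/
def MLP.eval (ρ : ℝ → ℝ) : {p q : ℕ} → MLP p q → (Fin p → ℝ) → Fin q → ℝ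
  | _, _, .last W, x => W x
  | _, _, .cons W M, x => M.eval ρ fun j => ρ (W x j)

/-- A `k`-th order invariant (linear) graph network on graphs with `n` vertices, with `s₀` input
features and output in `ℝ^s`. -/
structure IGN (n k s₀ s : ℕ) where
  /-- activation function between the equivariant layers -/
  σ : ℝ → ℝ
  /-- number of features after the last equivariant layer -/
  width : ℕ
  /-- the equivariant layers -/
  layers : EquivariantStack n k s₀ width
  /-- number of outputs of the invariant layer -/
  hidden : ℕ
  /-- the invariant layer -/
  inv : InvariantLayer n k width hidden
  /-- activation function of the perceptron -/
  ρ : ℝ → ℝ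
  /-- the final perceptron -/
  mlp : MLP hidden s

/-- The function `M ∘ I ∘ σ ∘ L⁽ᵈ⁾ ∘ ⋯ ∘ σ ∘ L⁽¹⁾` computed by an invariant graph network. -/
def IGN.eval {n k s₀ s : ℕ} (F : IGN n k s₀ s) (A : Tensor n k s₀) : Fin s → ℝ :=
  F.mlp.eval F.ρ (F.inv.toMap (F.layers.eval F.σ A))

/-- The rectified linear unit. -/
noncomputable def relu (x : ℝ) : ℝ := max x 0

open Classical in
/-- The tensor `A_G` of a graph: the one-hot encoding of the isomorphism types of its `k`-tuples,
with respect to an enumeration `c` of isomorphism types. -/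
noncomputable def graphTensor {n k s₀ : ℕ} {C : Type u} (c : Fin s₀ ↪ IsoType k C)
    (G : ColouredDigraph (Fin n) C) : Tensor n k s₀ :=
  fun v a => if isoType G v = c a then 1 else 0

/-- `G` and `H` are indistinguishable by `F`, i.e. `F(A_G) = F(A_H)`. As `F` takes tensors
of a fixed size as input, this includes that `G` and `H` have the same number of vertices. -/
def IGNIndist {n m k s₀ s : ℕ} {C : Type u} (F : IGN n k s₀ s) (c : Fin s₀ ↪ IsoType k C)
    (G : ColouredDigraph (Fin n) C) (H : ColouredDigraph (Fin m) C) : Prop :=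
  ∃ h : m = n, F.eval (graphTensor c G) = F.eval (graphTensor c (h ▸ H))

end WLIGN

open WLIGN

namespace WLIGN

/-! ### Counting and bijections -/

/-! From WL to networks: the coefficients of an equivariant affine layer depend only on the orbit of
a pair of tuples `(v, u)` under permutations of the vertices, that is, on its joint equality
pattern. Fix a round `T` after which no pair of tuples is newly separated. If `v` in `G` and `w` in
`H` share their colour in round `T`, then `exists_equiv_orbit` matches the tuples `u` with tuples `e
u` of the same colour lying in the same relative position, so both layers compute the same weighted
sum. By induction over layers, entries depend only on the stable colour, and the invariant layer
sums over equal multisets of colours.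

The matching is a count. Tuples `u` of a given colour with at least the coincidences `R` with `v`
arise from some `v ∘ f` by freeing positions. Colours pass to `v ∘ f` (`wlColour_comp`), refinement
counts each freed position (`card_agree_eq`), and inversion over supersets of `R` gives exact
patterns.

From networks to WL: with one-hot colours, a tuple's entry and its neighbourhood sums determine its
next colour. A linear functional separates the finitely many feature vectors occurring, and a ReLU
bump makes them one-hot again (`exists_two_layers`). Summing over tuples yields the colour histogram
of any chosen round. -/

theorem exists_equiv_of_card_fiber_eq {α β γ : Type*} [Fintype α] [Fintype β] [DecidableEq γ]
    {f : α → γ} {g : β → γ}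
    (h : ∀ c, (Finset.univ.filter fun a => f a = c).card =
      (Finset.univ.filter fun b => g b = c).card) :
    ∃ e : α ≃ β, ∀ a, f a = g (e a) := by
  have h' : ∀ c, Nonempty ({a // f a = c} ≃ {b // g b = c}) := fun c => by
    refine Fintype.card_eq.1 ?_
    rw [Fintype.card_subtype, Fintype.card_subtype, h c]
  refine ⟨Equiv.ofFiberEquiv fun c => (h' c).some, fun a => ?_⟩
  exact (Equiv.ofFiberEquiv_map (f := f) (g := g) _ a).symm

theorem map_univ_eq_iff_exists_equiv {α β γ : Type*} [Fintype α] [Fintype β]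
    {f : α → γ} {g : β → γ} :
    (Finset.univ : Finset α).val.map f = (Finset.univ : Finset β).val.map g ↔
      ∃ e : α ≃ β, ∀ a, f a = g (e a) := by
  classical
  constructor
  · intro h
    refine exists_equiv_of_card_fiber_eq fun c => ?_
    have := congrArg (Multiset.count c) h
    rw [Multiset.count_map, Multiset.count_map] at this
    simpa only [Finset.card_def, Finset.filter_val, eq_comm] using this
  · rintro ⟨e, he⟩
    rw [← Finset.map_univ_equiv e, Finset.map_val, Multiset.map_map]
    exact Multiset.map_congr rfl fun a _ => he a

/-- Isolates the exact fibre over `R` from those over strict supersets, so that it can be solved for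
by downward induction. -/
theorem card_filter_subset_eq_add {δ ι : Type*} [Fintype ι] [DecidableEq ι]
    (D : Finset δ) (p : δ → Finset ι) (R : Finset ι) :
    (D.filter fun a => R ⊆ p a).card =
      (D.filter fun a => p a = R).card +
        ∑ R' ∈ Finset.univ.filter (fun R' => R ⊂ R'), (D.filter fun a => p a = R').card := by
  classical
  have h₁ : (D.filter fun a => R ⊂ p a).card =
      ∑ R' ∈ Finset.univ.filter (fun R' => R ⊂ R'), (D.filter fun a => p a = R').card := by
    rw [Finset.card_eq_sum_card_fiberwise (f := p)
      (t := Finset.univ.filter fun R' => R ⊂ R')]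
    · refine Finset.sum_congr rfl fun R' hR' => ?_
      rw [Finset.filter_filter]
      congr 1
      ext a
      simp only [Finset.mem_filter, Finset.mem_univ, true_and] at hR' ⊢
      constructor
      · rintro ⟨h₁, -, h₂⟩
        exact ⟨h₁, h₂⟩
      · rintro ⟨h₁, rfl⟩
        exact ⟨h₁, hR', rfl⟩
    · intro a ha
      simpa using (Finset.mem_filter.1 ha).2
  rw [← h₁, ← Finset.card_union_of_disjoint, ← Finset.filter_or]
  · congr 1
    ext a
    simp only [Finset.mem_filter, and_congr_right_iff]
    intro _
    rw [eq_comm, subset_iff_ssubset_or_eq, or_comm]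
  · rw [Finset.disjoint_filter]
    rintro a - rfl
    exact fun h => h.ne rfl

/-- Inversion of the counting function of supersets. -/
theorem card_filter_eq_of_card_filter_subset {α β ι : Type*} [Fintype ι] [DecidableEq ι]
    {A : Finset α} {B : Finset β} {f : α → Finset ι} {g : β → Finset ι}
    (h : ∀ R, (A.filter fun a => R ⊆ f a).card = (B.filter fun b => R ⊆ g b).card)
    (R : Finset ι) :
    (A.filter fun a => f a = R).card = (B.filter fun b => g b = R).card := by
  induction R using WellFoundedGT.induction with
  | ind R ih =>
    have h₁ := h R
    rw [card_filter_subset_eq_add, card_filter_subset_eq_add] at h₁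
    rw [Finset.sum_congr rfl fun R' hR' => ih R' (Finset.mem_filter.1 hR').2] at h₁
    exact Nat.add_right_cancel h₁

/-- Two families with the same equality pattern differ by a permutation of the target. -/
theorem exists_perm_comp_eq {α β : Type*} [Fintype β] {a b : α → β}
    (h : ∀ i j, a i = a j ↔ b i = b j) : ∃ π : Equiv.Perm β, ∀ i, π (a i) = b i := by
  classical
  choose s hs using fun x : Set.range a => x.2
  choose s' hs' using fun x : Set.range b => x.2
  let e : {x // x ∈ Set.range a} ≃ {x // x ∈ Set.range b} :=
    { toFun := fun x => ⟨b (s x), s x, rfl⟩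
      invFun := fun x => ⟨a (s' x), s' x, rfl⟩
      left_inv := fun x => Subtype.ext <| by
        conv_rhs => rw [← hs x]
        rw [h, hs']
      right_inv := fun x => Subtype.ext <| by
        conv_rhs => rw [← hs' x]
        rw [← h, hs] }
  refine ⟨e.extendSubtype, fun i => ?_⟩
  rw [Equiv.extendSubtype_apply_of_mem _ _ ⟨i, rfl⟩]
  change b _ = b i
  rw [← h, hs]

/-! ### Properties of the Weisfeiler-Leman colouring -/

section Colouring

universe u

variable {n k : ℕ} {C : Type u} {G H : ColouredDigraph (Fin n) C}

theorem wlColour_eq_of_le {s t : ℕ} (hst : s ≤ t) {v w : Fin k → Fin n}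
    (h : wlColour G t v = wlColour H t w) : wlColour G s v = wlColour H s w := by
  induction t, hst using Nat.le_induction with
  | base => exact h
  | succ t _ ih => exact ih (congrArg Prod.fst h)

theorem exists_equiv_of_wlColour_succ {t : ℕ} {v w : Fin k → Fin n}
    (h : wlColour G (t + 1) v = wlColour H (t + 1) w) (i : Fin k) :
    ∃ e : Fin n ≃ Fin n, ∀ x, wlColour G t (Function.update v i x) =
      wlColour H t (Function.update w i (e x)) := by
  have h' : (Finset.univ : Finset (Fin n)).val.map
      (fun x => wlColour G t (Function.update v i x)) =
      (Finset.univ : Finset (Fin n)).val.map fun x => wlColour H t (Function.update w i x) :=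
    congrFun (congrArg Prod.snd h) i
  exact map_univ_eq_iff_exists_equiv.1 h'

theorem wlColour_succ_eq {t : ℕ} {v w : Fin k → Fin n} (h : wlColour G t v = wlColour H t w)
    (h' : ∀ i : Fin k, ∃ e : Fin n ≃ Fin n, ∀ x, wlColour G t (Function.update v i x) =
      wlColour H t (Function.update w i (e x))) :
    wlColour G (t + 1) v = wlColour H (t + 1) w := by
  refine Prod.ext h (funext fun i => ?_)
  change (Finset.univ : Finset (Fin n)).val.map
      (fun x => wlColour G t (Function.update v i x)) =
    (Finset.univ : Finset (Fin n)).val.map fun x => wlColour H t (Function.update w i x)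
  exact map_univ_eq_iff_exists_equiv.2 (h' i)

theorem eq_iff_eq_of_wlColour_eq {t : ℕ} {v w : Fin k → Fin n}
    (h : wlColour G t v = wlColour H t w) (i j : Fin k) : v i = v j ↔ w i = w j := by
  have h₀ : isoType G v = isoType H w := wlColour_eq_of_le (Nat.zero_le t) h
  exact iff_of_eq (congrFun (congrFun (congrArg IsoType.same h₀) i) j)

/-- Changing an entry of `v ∘ f` amounts to changing an entry of `v` and modifying `f`. -/
theorem exists_update_comp (f : Fin k → Fin k) (i : Fin k) :
    ∃ (j : Fin k) (f' : Fin k → Fin k), ∀ (v : Fin k → Fin n) (x : Fin n),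
      Function.update (v ∘ f) i x = Function.update v j x ∘ f' := by
  by_cases hf : Function.Surjective f
  · have hinj := Finite.injective_iff_surjective.2 hf
    refine ⟨f i, f, fun v x => funext fun l => ?_⟩
    by_cases hl : l = i
    · subst hl; simp
    · simp [Function.update_of_ne hl, Function.update_of_ne (hinj.ne hl)]
  -- Position `j` is not read by `f`, so it can store `x` without disturbing the other entries, and
  -- `i` is redirected to it.
  · obtain ⟨j, hj⟩ := not_forall.1 hf
    refine ⟨j, Function.update f i j, fun v x => funext fun l => ?_⟩
    by_cases hl : l = i
    · subst hl; simp
    · have : f l ≠ j := fun h => hj ⟨l, h⟩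
      simp [Function.update_of_ne hl, Function.update_of_ne this]

/-- The `j` and `f'` of `exists_update_comp` depend on neither the tuple nor `x`, so the bijection
for position `j` of `v` and `w` serves position `i` of `v ∘ f` and `w ∘ f`. -/
theorem wlColour_comp {t : ℕ} : ∀ {v w : Fin k → Fin n} (_ : wlColour G t v = wlColour H t w)
    (f : Fin k → Fin k), wlColour G t (v ∘ f) = wlColour H t (w ∘ f) := by
  induction t with
  | zero =>
    intro v w h f
    change isoType G v = isoType H w at h
    refine IsoType.ext (funext fun i => ?_) (funext fun i => funext fun j => ?_)
      (funext fun i => funext fun j => ?_)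
    · exact congrFun (congrArg IsoType.colour h) (f i)
    · exact congrFun (congrFun (congrArg IsoType.same h) (f i)) (f j)
    · exact congrFun (congrFun (congrArg IsoType.edge h) (f i)) (f j)
  | succ t ih =>
    intro v w h f
    refine wlColour_succ_eq (ih (congrArg Prod.fst h) f) fun i => ?_
    obtain ⟨j, f', hf'⟩ := exists_update_comp (n := n) f i
    obtain ⟨e, he⟩ := exists_equiv_of_wlColour_succ h j
    exact ⟨e, fun x => by rw [hf', hf']; exact ih (he x) f'⟩

variable (k G H) in
/-- In round `T` no pair of tuples remains to be distinguished later. -/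
def IsStableRound (T : ℕ) : Prop :=
  ∀ v w : Fin k → Fin n, wlColour G T v = wlColour H T w → ∀ t, wlColour G t v = wlColour H t w

variable (k G H) in
/-- After finitely many rounds the colouring of tuples is stable. -/
theorem exists_stable_round : ∃ T, IsStableRound k G H T := by
  have h : ∀ p : (Fin k → Fin n) × (Fin k → Fin n), ∃ T,
      wlColour G T p.1 = wlColour H T p.2 → ∀ t, wlColour G t p.1 = wlColour H t p.2 := by
    -- A pair separated in some round takes that round, vacuously; for a pair never separated any
    -- round works.
    intro p
    by_contra! hp
    obtain ⟨t, ht⟩ := (hp 0).2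
    exact ht (hp t).1
  choose T hT using h
  exact ⟨Finset.univ.sup T, fun v w hvw =>
    hT (v, w) (wlColour_eq_of_le (Finset.le_sup (f := T) (Finset.mem_univ (v, w))) hvw)⟩

open Classical in
-- Positions in `S` are freed one at a time. Each costs one refinement round, but stability lifts
-- equality in round `T` to round `T + 1`, so the induction never runs out of rounds.
theorem card_agree_eq {T : ℕ} (hT : IsStableRound k G H T) (S : Finset (Fin k)) : ∀ {v w : Fin k → Fin n}
    (_ : wlColour G T v = wlColour H T w) (d : WLColour k C T),
    (Finset.univ.filter fun u : Fin k → Fin n =>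
      (∀ j, j ∉ S → u j = v j) ∧ wlColour G T u = d).card =
    (Finset.univ.filter fun u : Fin k → Fin n =>
      (∀ j, j ∉ S → u j = w j) ∧ wlColour H T u = d).card := by
  induction S using Finset.induction_on with
  | empty =>
    intro v w h d
    have key : ∀ (X : ColouredDigraph (Fin n) C) (v : Fin k → Fin n),
        (Finset.univ.filter fun u : Fin k → Fin n =>
          (∀ j, j ∉ (∅ : Finset (Fin k)) → u j = v j) ∧ wlColour X T u = d).card =
        if wlColour X T v = d then 1 else 0 := by
      intro X v
      split_ifs with hv
      · refine Finset.card_eq_one.2 ⟨v, ?_⟩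
        ext u
        simp only [Finset.mem_filter, Finset.mem_univ, true_and, Finset.mem_singleton,
          Finset.notMem_empty, not_false_eq_true, forall_const, ← funext_iff]
        exact ⟨fun hu => hu.1, fun hu => ⟨hu, hu ▸ hv⟩⟩
      · refine Finset.card_eq_zero.2 (Finset.filter_false_of_mem ?_)
        rintro u - ⟨hu, hd⟩
        rw [funext fun j => hu j (Finset.notMem_empty j)] at hd
        exact hv hd
    rw [key, key, h]
  | insert i S hi ih =>
    intro v w h d
    have key : ∀ (X : ColouredDigraph (Fin n) C) (v : Fin k → Fin n),
        (Finset.univ.filter fun u : Fin k → Fin n =>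
          (∀ j, j ∉ insert i S → u j = v j) ∧ wlColour X T u = d).card =
        ∑ x, (Finset.univ.filter fun u : Fin k → Fin n =>
          (∀ j, j ∉ S → u j = Function.update v i x j) ∧ wlColour X T u = d).card := by
      intro X v
      rw [Finset.card_eq_sum_card_fiberwise (f := fun u => u i) (t := Finset.univ)
        fun _ _ => Finset.mem_coe.2 (Finset.mem_univ _)]
      refine Finset.sum_congr rfl fun x _ => ?_
      congr 1
      ext u
      simp only [Finset.mem_filter, Finset.mem_univ, true_and, Finset.mem_insert, not_or]
      constructor
      · rintro ⟨⟨h₁, h₂⟩, rfl⟩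
        refine ⟨fun j hj => ?_, h₂⟩
        by_cases hji : j = i
        · subst hji; simp
        · rw [Function.update_of_ne hji, h₁ j ⟨hji, hj⟩]
      · rintro ⟨h₁, h₂⟩
        refine ⟨⟨fun j hj => ?_, h₂⟩, ?_⟩
        · rw [h₁ j hj.2, Function.update_of_ne hj.1]
        · rw [h₁ i hi, Function.update_self]
    obtain ⟨e, he⟩ := exists_equiv_of_wlColour_succ (hT v w h (T + 1)) i
    rw [key, key, ← Equiv.sum_comp e fun x => (Finset.univ.filter fun u : Fin k → Fin n =>
      (∀ j, j ∉ S → u j = Function.update w i x j) ∧ wlColour H T u = d).card]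
    exact Finset.sum_congr rfl fun x _ => ih (he x) d

/-- The pairs of positions at which `v` and `u` have equal entries. -/
def coincidences (v u : Fin k → Fin n) : Finset (Fin k × Fin k) :=
  Finset.univ.filter fun p => v p.1 = u p.2

open Classical in
-- Containing `R` means agreeing with a fixed `v ∘ f` on the second coordinates of `R`, with all
-- other positions free, which is the situation of `card_agree_eq`.
theorem card_subset_coincidences_eq {T : ℕ} (hT : IsStableRound k G H T) {v w : Fin k → Fin n}
    (h : wlColour G T v = wlColour H T w) (d : WLColour k C T) (R : Finset (Fin k × Fin k)) :
    (Finset.univ.filter fun u : Fin k → Fin n =>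
      wlColour G T u = d ∧ R ⊆ coincidences v u).card =
    (Finset.univ.filter fun u : Fin k → Fin n =>
      wlColour H T u = d ∧ R ⊆ coincidences w u).card := by
  have hsub : ∀ v u : Fin k → Fin n, R ⊆ coincidences v u ↔ ∀ p ∈ R, v p.1 = u p.2 := by
    intro v u
    simp [Finset.subset_iff, coincidences]
  simp only [hsub]
  by_cases hR : ∀ p ∈ R, ∀ q ∈ R, p.2 = q.2 → v p.1 = v q.1
  -- `f j` is a position of `v` that `R` links to `j`; where there is none, `j` is a default value
  -- at a free position.
  · have hf : ∀ j, ∃ i, ∀ i', (i', j) ∈ R → (i, j) ∈ R := by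
      intro j
      by_cases hj : ∃ i, (i, j) ∈ R
      · obtain ⟨i, hi⟩ := hj
        exact ⟨i, fun _ _ => hi⟩
      · exact ⟨j, fun i' hi' => absurd ⟨i', hi'⟩ hj⟩
    choose f hf using hf
    have key : ∀ v u : Fin k → Fin n, (∀ p ∈ R, ∀ q ∈ R, p.2 = q.2 → v p.1 = v q.1) →
        ((∀ p ∈ R, v p.1 = u p.2) ↔
          ∀ j, j ∉ Finset.univ.filter (fun j => ∀ i, (i, j) ∉ R) → u j = (v ∘ f) j) := by
      intro v u hR
      simp only [Finset.mem_filter, Finset.mem_univ, true_and, not_forall, not_not]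
      constructor
      · rintro h₁ j ⟨i, hi⟩
        exact (h₁ _ (hf j i hi)).symm
      · rintro h₁ ⟨i, j⟩ hi
        rw [h₁ j ⟨i, hi⟩]
        exact hR _ hi _ (hf j i hi) rfl
    have hR' : ∀ p ∈ R, ∀ q ∈ R, p.2 = q.2 → w p.1 = w q.1 := fun p hp q hq hpq =>
      (eq_iff_eq_of_wlColour_eq h _ _).1 (hR p hp q hq hpq)
    simp only [key _ _ hR, key _ _ hR']
    have := card_agree_eq hT (Finset.univ.filter fun j => ∀ i, (i, j) ∉ R) (wlColour_comp h f) d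
    simpa only [and_comm] using this
  -- Here `R` forces two distinct entries of `v`, and likewise of `w`, to coincide, so both counts
  -- are zero.
  · push Not at hR
    obtain ⟨p, hp, q, hq, hpq, hne⟩ := hR
    have hne' : w p.1 ≠ w q.1 := fun h' => hne ((eq_iff_eq_of_wlColour_eq h _ _).2 h')
    rw [Finset.filter_false_of_mem, Finset.filter_false_of_mem]
    · rintro u - ⟨-, hu⟩
      exact hne' (by rw [hu p hp, hu q hq, hpq])
    · rintro u - ⟨-, hu⟩
      exact hne (by rw [hu p hp, hu q hq, hpq])

/-- Tuples with the same stable colour see the same coloured tuples in the same relative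
positions. -/
theorem exists_equiv_orbit {T : ℕ} (hT : IsStableRound k G H T) {v w : Fin k → Fin n}
    (h : wlColour G T v = wlColour H T w) :
    ∃ e : (Fin k → Fin n) ≃ (Fin k → Fin n), ∀ u, wlColour G T u = wlColour H T (e u) ∧
      ∃ π : Equiv.Perm (Fin n), (∀ i, π (v i) = w i) ∧ ∀ i, π (u i) = e u i := by
  classical
  obtain ⟨e, he⟩ := exists_equiv_of_card_fiber_eq
    (f := fun u => (wlColour G T u, coincidences v u))
    (g := fun u => (wlColour H T u, coincidences w u)) (by
      rintro ⟨d, R⟩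
      have := card_filter_eq_of_card_filter_subset
        (A := Finset.univ.filter fun u => wlColour G T u = d)
        (B := Finset.univ.filter fun u => wlColour H T u = d)
        (f := coincidences v) (g := coincidences w) (fun R => by
          rw [Finset.filter_filter, Finset.filter_filter]
          exact card_subset_coincidences_eq hT h d R) R
      simpa only [Finset.filter_filter, Prod.mk.injEq] using this)
  refine ⟨e, fun u => ?_⟩
  have hu := (Prod.ext_iff.1 (he u)).1
  have hc : ∀ i j, v i = u j ↔ w i = e u j := fun i j => by
    have := congrArg (fun R => (i, j) ∈ R) (Prod.ext_iff.1 (he u)).2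
    simpa [coincidences] using this
  -- Equality patterns inside each tuple come from the colours, those across the two tuples from the
  -- coincidence sets.
  obtain ⟨π, hπ⟩ := exists_perm_comp_eq (a := Sum.elim v u) (b := Sum.elim w (e u)) (by
    rintro (i | i) (j | j)
    · exact eq_iff_eq_of_wlColour_eq h i j
    · exact hc i j
    · simpa only [eq_comm, Sum.elim_inl, Sum.elim_inr] using hc j i
    · exact eq_iff_eq_of_wlColour_eq hu i j)
  exact ⟨hu, π, fun i => hπ (Sum.inl i), fun i => hπ (Sum.inr i)⟩

end Colouring


/-! ### Invariant graph networks respect the stable colouring -/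

section Upper

universe u

variable {n k p q : ℕ}

/-- The tensor with a single nonzero entry, equal to `1`. -/
noncomputable def unitTensor (w : Fin k → Fin n) (a : Fin p) : Tensor n k p :=
  Pi.single w (Pi.single a 1)

theorem tensor_eq_sum_unitTensor (A : Tensor n k p) :
    A = ∑ w, ∑ a, A w a • unitTensor w a := by
  ext v b
  simp only [Finset.sum_apply, Pi.smul_apply, unitTensor, smul_eq_mul]
  rw [Finset.sum_eq_single v, Finset.sum_eq_single b]
  · simp
  · intro a _ ha
    simp [Pi.single_eq_of_ne ha.symm]
  · simp
  · intro w _ hw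
    simp [Pi.single_eq_of_ne hw.symm]
  · simp

theorem permAct_unitTensor (π : Equiv.Perm (Fin n)) (w : Fin k → Fin n) (a : Fin p) :
    permAct π (unitTensor w a) = unitTensor (fun i => π (w i)) a := by
  ext v b
  have : (fun i => π.symm (v i)) = w ↔ v = fun i => π (w i) := by
    simp only [funext_iff, Equiv.symm_apply_eq]
  by_cases h : v = fun i => π (w i)
  · simp only [permAct, unitTensor]
    rw [this.2 h, h, Pi.single_eq_same, Pi.single_eq_same]
  · simp only [permAct, unitTensor]
    rw [Pi.single_eq_of_ne h, Pi.single_eq_of_ne (mt this.1 h)]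

theorem permAct_zero (π : Equiv.Perm (Fin n)) : permAct π (0 : Tensor n k p) = 0 := rfl

theorem affineMap_tensor_apply {E : Type*} [AddCommGroup E] [Module ℝ E]
    (L : Tensor n k p →ᵃ[ℝ] E) (A : Tensor n k p) :
    L A = ∑ w, ∑ a, A w a • L.linear (unitTensor w a) + L 0 := by
  conv_lhs => rw [L.decomp]
  simp only [Pi.add_apply]
  congr 1
  conv_lhs => rw [tensor_eq_sum_unitTensor A]
  simp only [map_sum, map_smul]

theorem linear_eq_sub_zero {E F : Type*} [AddCommGroup E] [Module ℝ E] [AddCommGroup F]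
    [Module ℝ F] (L : E →ᵃ[ℝ] F) (x : E) : L.linear x = L x - L 0 :=
  congrFun L.decomp' x

/-- The zero tensor is fixed by all permutations, so the bias is itself equivariant and may be split
off from the linear part. -/
theorem EquivariantLayer.zero_apply (L : EquivariantLayer n k p q) (π : Equiv.Perm (Fin n))
    (v : Fin k → Fin n) : L.toMap 0 (fun i => π (v i)) = L.toMap 0 v := by
  conv_lhs => rw [← permAct_zero π, L.equivariant, permAct_apply]

theorem EquivariantLayer.linear_apply (L : EquivariantLayer n k p q) (π : Equiv.Perm (Fin n))
    (v w : Fin k → Fin n) (a : Fin p) :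
    L.toMap.linear (unitTensor (fun i => π (w i)) a) (fun i => π (v i)) =
      L.toMap.linear (unitTensor w a) v := by
  rw [linear_eq_sub_zero, linear_eq_sub_zero, ← permAct_unitTensor, L.equivariant,
    Pi.sub_apply, Pi.sub_apply, permAct_apply, L.zero_apply]

theorem InvariantLayer.linear_apply (L : InvariantLayer n k p q) (π : Equiv.Perm (Fin n))
    (w : Fin k → Fin n) (a : Fin p) :
    L.toMap.linear (unitTensor (fun i => π (w i)) a) = L.toMap.linear (unitTensor w a) := by
  rw [linear_eq_sub_zero, linear_eq_sub_zero, ← permAct_unitTensor, L.invariant]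

variable {C : Type u} {G H : ColouredDigraph (Fin n) C} {T : ℕ}

variable (G H T) in
/-- The entries of `A` at tuples of `G` and of `B` at tuples of `H` depend only on the colour
in round `T`. -/
def RespectsColour (A B : Tensor n k p) : Prop :=
  ∀ v w, wlColour G T v = wlColour H T w → A v = B w

theorem RespectsColour.layer (hT : IsStableRound k G H T) {A B : Tensor n k p}
    (hAB : RespectsColour G H T A B) (L : EquivariantLayer n k p q) :
    RespectsColour G H T (L.toMap A) (L.toMap B) := by
  intro v w h
  obtain ⟨e, he⟩ := exists_equiv_orbit hT h
  -- Any permutation carrying `v` to `w` will do: it is needed only for the bias.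
  obtain ⟨-, π, hπ, -⟩ := he v
  rw [affineMap_tensor_apply, affineMap_tensor_apply L.toMap B, Pi.add_apply, Pi.add_apply,
    ← L.zero_apply π v, funext hπ]
  congr 1
  simp only [Finset.sum_apply, Pi.smul_apply]
  refine Fintype.sum_equiv e _ _ fun u => Finset.sum_congr rfl fun a _ => ?_
  obtain ⟨hu, π, hv, hu'⟩ := he u
  rw [hAB u (e u) hu, ← L.linear_apply π v u, funext hv, funext hu']

theorem RespectsColour.stack (hT : IsStableRound k G H T) (σ : ℝ → ℝ) {A B : Tensor n k p}
    (hAB : RespectsColour G H T A B) (S : EquivariantStack n k p q) :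
    RespectsColour G H T (S.eval σ A) (S.eval σ B) := by
  induction S with
  | nil => simpa only [EquivariantStack.eval] using hAB
  | snoc S L ih =>
    intro v w h
    funext a
    simp only [EquivariantStack.eval]
    exact congrArg σ (congrFun (ih.layer hT L v w h) a)

/-- An invariant coefficient depends only on the equality pattern of one tuple, which its colour
records, so a colour-preserving bijection of all tuples suffices. -/
theorem RespectsColour.invariantLayer {A B : Tensor n k p}
    (hAB : RespectsColour G H T A B) (L : InvariantLayer n k p q) (hGH : WLIndist k G H) :
    L.toMap A = L.toMap B := by
  obtain ⟨e, he⟩ := map_univ_eq_iff_exists_equiv.1 (hGH T)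
  rw [affineMap_tensor_apply, affineMap_tensor_apply L.toMap B]
  congr 1
  refine Fintype.sum_equiv e _ _ fun u => Finset.sum_congr rfl fun a _ => ?_
  obtain ⟨π, hπ⟩ := exists_perm_comp_eq (eq_iff_eq_of_wlColour_eq (he u))
  rw [hAB u (e u) (he u), ← L.linear_apply π u, funext hπ]

theorem IGN.eval_eq_of_wlIndist {s₀ s : ℕ} (hGH : WLIndist k G H) (F : IGN n k s₀ s)
    (c : Fin s₀ ↪ IsoType k C) : F.eval (graphTensor c G) = F.eval (graphTensor c H) := by
  obtain ⟨T, hT⟩ := exists_stable_round k G H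
  have h₀ : RespectsColour G H T (graphTensor c G) (graphTensor c H) := by
    intro v w h
    have : isoType G v = isoType H w := wlColour_eq_of_le (Nat.zero_le T) h
    funext a
    simp only [graphTensor]
    rw [this]
  exact congrArg (F.mlp.eval F.ρ) ((h₀.stack hT F.σ F.layers).invariantLayer F.inv hGH)

theorem eq_of_wlIndist {m : ℕ} {H : ColouredDigraph (Fin m) C} (hk : k ≠ 0)
    (hGH : WLIndist k G H) : m = n := by
  have := congrArg Multiset.card (hGH 0)
  simp only [Multiset.card_map, Finset.card_val, Finset.card_univ, Fintype.card_fun,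
    Fintype.card_fin] at this
  exact (Nat.pow_left_injective hk this).symm

end Upper

/-! ### A network simulating the Weisfeiler-Leman colouring -/

section Lower

universe u

/-- Finitely many vectors can be separated, with gaps at least one, by a linear functional. -/
theorem exists_dual_separating {ι V : Type*} [Finite ι] [AddCommGroup V] [Module ℝ V]
    (z : ι → V) :
    ∃ φ : V →ₗ[ℝ] ℝ, ∀ i j, z i ≠ z j → 1 ≤ |φ (z i) - φ (z j)| := by
  classical
  have := Fintype.ofFinite ι
  let J := {p : ι × ι // z p.1 ≠ z p.2}
  obtain ⟨f, hf⟩ := Module.exists_dual_forall_apply_ne_zero (K := ℝ)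
    (fun p : J => z p.1.1 - z p.1.2) fun p => sub_ne_zero.2 p.2
  have hb : ∀ p : J, |f (z p.1.1 - z p.1.2)|⁻¹ ≤ ∑ p : J, |f (z p.1.1 - z p.1.2)|⁻¹ := fun p =>
    Finset.single_le_sum (f := fun p : J => |f (z p.1.1 - z p.1.2)|⁻¹)
      (fun _ _ => by positivity) (Finset.mem_univ p)
  -- The scaling factor dominates the inverse of every gap, so all gaps become at least one.
  refine ⟨(∑ p : J, |f (z p.1.1 - z p.1.2)|⁻¹) • f, fun i j hij => ?_⟩
  have hpos : 0 < |f (z i - z j)| := abs_pos.2 (hf ⟨(i, j), hij⟩)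
  have h₀ : 0 ≤ ∑ p : J, |f (z p.1.1 - z p.1.2)|⁻¹ :=
    Finset.sum_nonneg fun _ _ => by positivity
  rw [← map_sub, LinearMap.smul_apply, smul_eq_mul, abs_mul, abs_of_nonneg h₀]
  calc (1 : ℝ) = |f (z i - z j)|⁻¹ * |f (z i - z j)| := (inv_mul_cancel₀ hpos.ne').symm
    _ ≤ _ := mul_le_mul_of_nonneg_right (hb ⟨(i, j), hij⟩) hpos.le

/-- Since `relu x + relu (-x) = |x|`, the bump is `max (1 - |x|) 0`, which is the indicator of zero
on inputs that are zero or of absolute value at least one. -/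
theorem relu_bump_zero : relu (1 - relu 0 - relu (-0)) = 1 := by
  simp [relu]

theorem relu_bump_of_one_le_abs {x : ℝ} (hx : 1 ≤ |x|) : relu (1 - relu x - relu (-x)) = 0 := by
  rcases le_abs.1 hx with h | h
  · simp only [relu]
    rw [max_eq_left (by linarith : (0 : ℝ) ≤ x), max_eq_right (by linarith : -x ≤ 0),
      max_eq_right (by linarith)]
  · simp only [relu]
    rw [max_eq_right (by linarith : x ≤ 0), max_eq_left (by linarith : (0 : ℝ) ≤ -x),
      max_eq_right (by linarith)]

variable {n k p q : ℕ}

/-- The features of a tuple that are used in a refinement round: its own entry, and for each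
position the sum of the entries over all replacements at this position. -/
def neighbourhood (v : Fin k → Fin n) :
    Tensor n k p →ₗ[ℝ] (Fin p → ℝ) × (Fin k → Fin p → ℝ) where
  toFun A := (A v, fun i => ∑ x, A (Function.update v i x))
  map_add' A B := by
    refine Prod.ext rfl (funext fun i => ?_)
    simp [Finset.sum_add_distrib]
  map_smul' r A := by
    refine Prod.ext rfl (funext fun i => ?_)
    simp [Finset.smul_sum]

theorem neighbourhood_permAct (π : Equiv.Perm (Fin n)) (A : Tensor n k p) (v : Fin k → Fin n) :
    neighbourhood v (permAct π A) = neighbourhood (fun i => π.symm (v i)) A := by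
  refine Prod.ext rfl (funext fun i => ?_)
  simp only [neighbourhood, LinearMap.coe_mk, AddHom.coe_mk, permAct]
  rw [← Equiv.sum_comp π.symm fun x => A (Function.update (fun i => π.symm (v i)) i x)]
  refine Finset.sum_congr rfl fun x _ => congrArg A (funext fun j => ?_)
  by_cases hj : j = i
  · subst hj; simp
  · simp [Function.update_of_ne hj]

/-- The equivariant layer applying affine functionals to the refinement features. -/
def neighbourhoodLayer (φ : Fin q → (Fin p → ℝ) × (Fin k → Fin p → ℝ) →ₗ[ℝ] ℝ) (b : Fin q → ℝ) :
    EquivariantLayer n k p q where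
  toMap := (LinearMap.pi fun v => LinearMap.pi fun a => φ a ∘ₗ neighbourhood v).toAffineMap +
    AffineMap.const ℝ _ fun _ => b
  equivariant π A := by
    funext v a
    change φ a (neighbourhood v (permAct π A)) + b a =
      φ a (neighbourhood (fun i => π.symm (v i)) A) + b a
    rw [neighbourhood_permAct]

theorem neighbourhoodLayer_apply (φ : Fin q → (Fin p → ℝ) × (Fin k → Fin p → ℝ) →ₗ[ℝ] ℝ)
    (b : Fin q → ℝ) (A : Tensor n k p) (v : Fin k → Fin n) (a : Fin q) :
    (neighbourhoodLayer φ b).toMap A v a = φ a (neighbourhood v A) + b a := rfl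

/-- The invariant layer summing all entries. -/
def sumLayer (n k p : ℕ) : InvariantLayer n k p p where
  toMap := (∑ v, LinearMap.proj v : Tensor n k p →ₗ[ℝ] (Fin p → ℝ)).toAffineMap
  invariant π A := by
    simp only [LinearMap.coe_toAffineMap, LinearMap.coe_sum, Finset.sum_apply,
      LinearMap.coe_proj, Function.eval]
    exact Equiv.sum_comp (Equiv.arrowCongr (Equiv.refl _) π.symm) A

theorem sumLayer_apply (A : Tensor n k p) : (sumLayer n k p).toMap A = ∑ v, A v := by
  simp [sumLayer]

variable {C : Type u}

/-- A tensor is the one-hot encoding of the colours of the tuples of `X` in round `t`. -/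
def IsOneHot {t : ℕ} (c : Fin p ↪ WLColour k C t) (X : ColouredDigraph (Fin n) C)
    (A : Tensor n k p) : Prop :=
  ∀ v, ∃ a, c a = wlColour X t v ∧ A v = Pi.single a 1

open Classical in
-- A sum of one-hot vectors is the histogram of the colours, hence determines their multiset.
theorem IsOneHot.sum_eq_sum_iff {t : ℕ} {c : Fin p ↪ WLColour k C t}
    {X Y : ColouredDigraph (Fin n) C} {A B : Tensor n k p} (hA : IsOneHot c X A)
    (hB : IsOneHot c Y B) {ι : Type*} [Fintype ι] (f g : ι → Fin k → Fin n) :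
    ∑ x, A (f x) = ∑ x, B (g x) ↔
      (Finset.univ : Finset ι).val.map (fun x => wlColour X t (f x)) =
        (Finset.univ : Finset ι).val.map (fun x => wlColour Y t (g x)) := by
  have key : ∀ (X : ColouredDigraph (Fin n) C) (A : Tensor n k p) (_ : IsOneHot c X A)
      (f : ι → Fin k → Fin n) (a : Fin p), (∑ x, A (f x)) a =
        ((Finset.univ.filter fun x => wlColour X t (f x) = c a).card : ℝ) := by
    intro X A hA f a
    rw [Finset.sum_apply, Finset.card_filter, Nat.cast_sum]
    refine Finset.sum_congr rfl fun x _ => ?_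
    obtain ⟨b, hb, hAb⟩ := hA (f x)
    rw [hAb, ← hb]
    by_cases hab : a = b
    · subst hab; simp
    · simp [Pi.single_eq_of_ne hab, c.injective.ne (Ne.symm hab)]
  rw [map_univ_eq_iff_exists_equiv]
  constructor
  · intro h
    refine exists_equiv_of_card_fiber_eq (f := fun x => wlColour X t (f x))
      (g := fun x => wlColour Y t (g x)) fun d => ?_
    by_cases hd : d ∈ Set.range c
    · obtain ⟨a, rfl⟩ := hd
      have := congrFun h a
      rw [key X A hA, key Y B hB] at this
      exact_mod_cast this
    · rw [Finset.filter_false_of_mem, Finset.filter_false_of_mem]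
      · rintro x - rfl
        obtain ⟨b, hb, -⟩ := hB (g x)
        exact hd ⟨b, hb⟩
      · rintro x - rfl
        obtain ⟨b, hb, -⟩ := hA (f x)
        exact hd ⟨b, hb⟩
  · rintro ⟨e, he⟩
    rw [← Equiv.sum_comp e fun x => B (g x)]
    refine Finset.sum_congr rfl fun x _ => ?_
    obtain ⟨a, ha, hAa⟩ := hA (f x)
    obtain ⟨b, hb, hBb⟩ := hB (g (e x))
    rw [hAa, hBb, c.injective (ha.trans ((he x).trans hb.symm))]

theorem IsOneHot.eq_iff {t : ℕ} {c : Fin p ↪ WLColour k C t}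
    {X Y : ColouredDigraph (Fin n) C} {A B : Tensor n k p} (hA : IsOneHot c X A)
    (hB : IsOneHot c Y B) (v w : Fin k → Fin n) :
    A v = B w ↔ wlColour X t v = wlColour Y t w := by
  obtain ⟨a, ha, hAa⟩ := hA v
  obtain ⟨b, hb, hBb⟩ := hB w
  rw [hAa, hBb, ← ha, ← hb, c.injective.eq_iff]
  refine ⟨fun h => ?_, fun h => by rw [h]⟩
  by_contra hab
  have := congrFun h a
  rw [Pi.single_eq_same, Pi.single_eq_of_ne hab] at this
  exact one_ne_zero this

/-- The linear features lose nothing: they hold the previous colour and, for each position, the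
histogram of colours over replacements. -/
theorem IsOneHot.neighbourhood_eq_iff {t : ℕ} {c : Fin p ↪ WLColour k C t}
    {X Y : ColouredDigraph (Fin n) C} {A B : Tensor n k p} (hA : IsOneHot c X A)
    (hB : IsOneHot c Y B) (v w : Fin k → Fin n) :
    neighbourhood v A = neighbourhood w B ↔ wlColour X (t + 1) v = wlColour Y (t + 1) w := by
  refine Prod.ext_iff.trans (Iff.trans ?_ Prod.ext_iff.symm)
  refine and_congr (hA.eq_iff hB v w) (funext_iff.trans (Iff.trans ?_ funext_iff.symm))
  exact forall_congr' fun i => hA.sum_eq_sum_iff hB (fun x => Function.update v i x)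
    fun x => Function.update w i x

/-- One round of colour refinement can be performed by two layers. -/
theorem exists_two_layers {ι : Type} [Fintype ι] (X : ι → ColouredDigraph (Fin n) C) {t : ℕ}
    {c : Fin p ↪ WLColour k C t} {A : ι → Tensor n k p} (hA : ∀ j, IsOneHot c (X j) (A j)) :
    ∃ (q r : ℕ) (L₁ : EquivariantLayer n k p q) (L₂ : EquivariantLayer n k q r)
      (c' : Fin r ↪ WLColour k C (t + 1)), ∀ j, IsOneHot c' (X j)
        (fun v a => relu (L₂.toMap (fun v a => relu (L₁.toMap (A j) v a)) v a)) := by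
  classical
  let D : Finset (WLColour k C (t + 1)) :=
    Finset.univ.image fun s : ι × (Fin k → Fin n) => wlColour (X s.1) (t + 1) s.2
  let z : ι × (Fin k → Fin n) → (Fin p → ℝ) × (Fin k → Fin p → ℝ) :=
    fun s => neighbourhood s.2 (A s.1)
  have hz : ∀ s s', z s = z s' ↔
      wlColour (X s.1) (t + 1) s.2 = wlColour (X s'.1) (t + 1) s'.2 := fun s s' =>
    (hA s.1).neighbourhood_eq_iff (hA s'.1) s.2 s'.2
  obtain ⟨φ, hφ⟩ := exists_dual_separating z
  let e : Fin D.card ≃ D := D.equivFin.symm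
  have hrep : ∀ a : Fin D.card, ∃ s : ι × (Fin k → Fin n),
      wlColour (X s.1) (t + 1) s.2 = (e a : WLColour k C (t + 1)) := fun a => by
    obtain ⟨s, -, hs⟩ := Finset.mem_image.1 (e a).2
    exact ⟨s, hs⟩
  choose rep hrep using hrep
  let e₂ : Fin (D.card * 2) ≃ Fin D.card × Fin 2 := finProdFinEquiv.symm
  let sgn : Fin 2 → ℝ := fun s => if s = 0 then 1 else -1
  -- Two hidden features per colour hold `x` and `-x` before activation, where `x` is the difference
  -- of the `φ`-values of the tuple and of the representative. `L₂` then assembles the bump from the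
  -- tuple's own entry alone.
  let L₁ : EquivariantLayer n k p (D.card * 2) := neighbourhoodLayer
    (fun b => sgn (e₂ b).2 • φ) fun b => -(sgn (e₂ b).2 * φ (z (rep (e₂ b).1)))
  let pr : Fin D.card × Fin 2 → (Fin (D.card * 2) → ℝ) →ₗ[ℝ] ℝ := fun b =>
    LinearMap.proj (e₂.symm b)
  let L₂ : EquivariantLayer n k (D.card * 2) D.card := neighbourhoodLayer
    (fun a => -(pr (a, 0) + pr (a, 1)) ∘ₗ LinearMap.fst ℝ _ _) fun _ => 1
  refine ⟨D.card * 2, D.card, L₁, L₂,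
    e.toEmbedding.trans (Function.Embedding.subtype _), fun j v => ?_⟩
  have hmem : wlColour (X j) (t + 1) v ∈ D := Finset.mem_image_of_mem
    (fun s : ι × (Fin k → Fin n) => wlColour (X s.1) (t + 1) s.2) (Finset.mem_univ (j, v))
  refine ⟨e.symm ⟨_, hmem⟩, by simp, funext fun a => ?_⟩
  have hval : ∀ a, L₂.toMap (fun v b => relu (L₁.toMap (A j) v b)) v a =
      1 - relu (φ (z (j, v)) - φ (z (rep a))) - relu (-(φ (z (j, v)) - φ (z (rep a)))) := by
    intro a
    simp only [L₁, L₂, neighbourhoodLayer_apply]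
    simp [neighbourhood, sgn, z, pr]
    ring_nf
  beta_reduce
  rw [hval]
  by_cases ha : a = e.symm ⟨_, hmem⟩
  · have : z (j, v) = z (rep a) := by
      rw [hz, hrep, ha, Equiv.apply_symm_apply]
    rw [this, sub_self, relu_bump_zero, ← ha, Pi.single_eq_same]
  · have : z (j, v) ≠ z (rep a) := by
      rw [Ne, hz, hrep]
      intro h
      exact ha ((Equiv.eq_symm_apply e).2 (Subtype.ext h.symm))
    rw [relu_bump_of_one_le_abs (hφ _ _ this), Pi.single_eq_of_ne ha]

/-- The input is already one-hot for round zero, and each further round adds two layers. One stack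
and one enumeration of colours serve the whole family, which makes outputs comparable across graphs.
-/
theorem exists_stack_isOneHot {ι : Type} [Fintype ι] (X : ι → ColouredDigraph (Fin n) C)
    {s₀ : ℕ} (c : Fin s₀ ↪ IsoType k C)
    (hc : ∀ j (v : Fin k → Fin n), isoType (X j) v ∈ Set.range c) (t : ℕ) :
    ∃ (p : ℕ) (S : EquivariantStack n k s₀ p) (c' : Fin p ↪ WLColour k C t),
      ∀ j, IsOneHot c' (X j) (S.eval relu (graphTensor c (X j))) := by
  induction t with
  | zero =>
    refine ⟨s₀, .nil s₀, c, fun j v => ?_⟩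
    obtain ⟨a, ha⟩ := hc j v
    refine ⟨a, ha, funext fun b => ?_⟩
    simp only [EquivariantStack.eval, graphTensor, ← ha, c.injective.eq_iff, Pi.single_apply,
      eq_comm]
  | succ t ih =>
    obtain ⟨p, S, c', hS⟩ := ih
    obtain ⟨q, r, L₁, L₂, c'', h⟩ := exists_two_layers X hS
    exact ⟨r, (S.snoc L₁).snoc L₂, c'', by simpa only [EquivariantStack.eval] using h⟩

/-- The network summing the output of a stack of layers over all tuples. -/
noncomputable def EquivariantStack.toIGN (S : EquivariantStack n k p q) : IGN n k p q where
  σ := relu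
  width := q
  layers := S
  hidden := q
  inv := sumLayer n k q
  ρ := relu
  mlp := .last (AffineMap.id ℝ _)

theorem EquivariantStack.toIGN_eval (S : EquivariantStack n k p q) (A : Tensor n k p) :
    S.toIGN.eval A = ∑ v, S.eval relu A v :=
  sumLayer_apply _

/-- Each round of the Weisfeiler-Leman algorithm can be simulated by a network. -/
theorem exists_ign_wlIndistAt (G H : ColouredDigraph (Fin n) C) {s₀ : ℕ}
    (c : Fin s₀ ↪ IsoType k C) (hG : ∀ v : Fin k → Fin n, isoType G v ∈ Set.range c)
    (hH : ∀ v : Fin k → Fin n, isoType H v ∈ Set.range c) (t : ℕ) :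
    ∃ (s : ℕ) (F : IGN n k s₀ s), F.σ = relu ∧ F.ρ = relu ∧
      (F.eval (graphTensor c G) = F.eval (graphTensor c H) → WLIndistAt k t G H) := by
  obtain ⟨p, S, c', hS⟩ := exists_stack_isOneHot (fun b : Bool => cond b G H) c
    (by rintro (_ | _); exacts [hH, hG]) t
  refine ⟨p, S.toIGN, rfl, rfl, fun h => ?_⟩
  rw [S.toIGN_eval, S.toIGN_eval] at h
  exact ((hS true).sum_eq_sum_iff (hS false) id id).1 h

end Lower

end WLIGN

theorem theorem2 {C : Type*} (k : ℕ) (hk : 2 ≤ k) (n m : ℕ)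
    (G : ColouredDigraph (Fin n) C) (H : ColouredDigraph (Fin m) C)
    (s₀ : ℕ) (c : Fin s₀ ↪ IsoType k C)
    (hG : ∀ v : Fin k → Fin n, isoType G v ∈ Set.range c)
    (hH : ∀ w : Fin k → Fin m, isoType H w ∈ Set.range c) :
    (WLIndist k G H → ∀ (s : ℕ) (F : IGN n k s₀ s), IGNIndist F c G H) ∧
      ∃ (s : ℕ) (F : IGN n k s₀ s), F.σ = relu ∧ F.ρ = relu ∧
        (IGNIndist F c G H → WLIndist k G H) := by
  constructor
  · intro h s F
    obtain rfl := eq_of_wlIndist (by omega) h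
    exact ⟨rfl, F.eval_eq_of_wlIndist h c⟩
  -- The network may depend on `G` and `H`: if they are distinguished, it simulates one round that
  -- does so. If they are not, or if the sizes differ, any network will do.
  · by_cases hmn : m = n
    · subst hmn
      by_cases h : WLIndist k G H
      · exact ⟨s₀, (EquivariantStack.nil s₀).toIGN, rfl, rfl, fun _ => h⟩
      · obtain ⟨t, ht⟩ := not_forall.1 h
        obtain ⟨s, F, hσ, hρ, hF⟩ := exists_ign_wlIndistAt G H c hG hH t
        exact ⟨s, F, hσ, hρ, fun ⟨_, h'⟩ => absurd (hF h') ht⟩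
    · exact ⟨s₀, (EquivariantStack.nil s₀).toIGN, rfl, rfl, fun ⟨h, _⟩ => absurd h hmn⟩
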